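/- Let $0<r_e<r_s$, $\lambda,\mu\ge 0$ and $0\le\kappa\le\pi/2$. Let $\Xi$ be a Poisson point process on $[0,\pi)\times[0,\pi)$ with density $\lambda\sin(\phi)/(2\pi)$ at $(\theta,\phi)$. Each point $(\theta,\phi)$ of $\Xi$ gives a circular orbit $l(\theta,\phi)\subset\mathbb R^3$ of radius $r_s$ centered at the origin, with longitude $\theta$ and inclination $\phi$. Let $\Psi$ (the satellites) be the Cox point process on $\mathbb R^3$ that, conditionally on $\Xi$, consists of independent Poisson point processes of intensity $\mu/(2\pi r_s)$ per unit length on these orbits. Let $U=(0,0,r_e)$ be the typical terrestrial gateway; the elevation angle of a point $X$ at $U$ is the signed angle between the segment $UX$ and the horizontal plane through $U$. Suppose that there are no aerial platforms and that terrestrial nodes can receive messages only from satellites whose elevation angle is greater than $\kappa$. Then the connectivity probability, that is, the probability that $\Psi$ has at least one satellite whose elevation angle at $U$ is greater than $\kappa$, equals $$1-\exp\left(-\lambda\int_0^{\tilde\xi}\cos(\varphi)\left(1-e^{-\frac{\mu}{\pi}\arcsin\left(\sqrt{1-\cos^2(\tilde\xi)\sec^2(\varphi)}\right)}\right)d\varphi\right),$$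 where $$\tilde\xi=\arccos\left(\frac{r_e^2+r_s^2-y^2}{2r_sr_e}\right),\qquad y=-r_e\sin\kappa+\sqrt{r_s^2-r_e^2\cos^2\kappa}.$$ -/

import Mathlib

open MeasureTheory ProbabilityTheory Set
open scoped ENNReal NNReal

noncomputable section

/-- Three-dimensional Euclidean space, with the Earth's center at the origin. -/
abbrev Space3 : Type := EuclideanSpace ℝ (Fin 3)

/-! ### Poisson and Cox point processes -/

/-- The Poisson law with mean `r`, as a law on `[0, ∞]`; for `r = ∞` it is concentrated at `∞`. -/
def poissonLaw (r : ℝ≥0∞) : Measure ℝ≥0∞ :=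
  if r = ∞ then Measure.dirac ∞
  else (poissonMeasure r.toNNReal).map (fun k : ℕ => (k : ℝ≥0∞))

/-- `N` is a point process on `E`: a random measure that is almost surely a countable sum of unit
point masses. `N ω B` is the number of points in `B`. -/
structure IsPointProcess {Ω E : Type*} [MeasurableSpace Ω] [MeasurableSpace E]
    (P : Measure Ω) (N : Ω → Measure E) : Prop where
  measurable : Measurable N
  sum_dirac : ∀ᵐ ω ∂P, ∃ (s : Set ℕ) (x : s → E), N ω = Measure.sum fun i => Measure.dirac (x i)

/-- `N` is a Poisson point process with intensity measure `Λ`: the numbers of points in finitely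
many pairwise disjoint measurable sets are independent Poisson variables with means `Λ (B i)`. -/
structure IsPoissonPointProcess {Ω E : Type*} [MeasurableSpace Ω] [MeasurableSpace E]
    (P : Measure Ω) (N : Ω → Measure E) (Λ : Measure E) : Prop where
  pointProcess : IsPointProcess P N
  law : ∀ (n : ℕ) (B : Fin n → Set E), (∀ i, MeasurableSet (B i)) →
    Pairwise (fun i j => Disjoint (B i) (B j)) →
    P.map (fun ω i => N ω (B i)) = Measure.pi fun i => poissonLaw (Λ (B i))

/-- `N` is a Cox point process directed by the point process `Ξ`: conditionally on `Ξ = ξ`, it is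
a Poisson point process with intensity measure `Λ ξ`. -/
structure IsCoxPointProcess {Ω S E : Type*} [MeasurableSpace Ω] [MeasurableSpace S]
    [MeasurableSpace E] (P : Measure Ω) [IsFiniteMeasure P] (Ξ : Ω → Measure S)
    (N : Ω → Measure E) (Λ : Measure S → Measure E) : Prop where
  pointProcess : IsPointProcess P N
  condLaw : ∀ (n : ℕ) (B : Fin n → Set E), (∀ i, MeasurableSet (B i)) →
    Pairwise (fun i j => Disjoint (B i) (B j)) →
    condDistrib (fun ω i => N ω (B i)) Ξ P =ᵐ[P.map Ξ]
      fun ξ => Measure.pi fun i => poissonLaw (Λ ξ (B i))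

/-! ### Orbits and satellites -/

/-- The intensity measure of the orbit process, with density `lam * sin φ / (2π)` at `(θ, φ)` in
the rectangle `[0, π) × [0, π)`; `θ` is the longitude and `φ` the inclination. -/
def orbitIntensity (lam : ℝ) : Measure (ℝ × ℝ) :=
  ((volume : Measure (ℝ × ℝ)).restrict (Ico 0 Real.pi ×ˢ Ico 0 Real.pi)).withDensity
    fun p => ENNReal.ofReal (lam * Real.sin p.2 / (2 * Real.pi))

/-- The point with argument angle `w` on the orbit of radius `rs`, longitude `p.1` and
inclination `p.2`. -/
def orbitPoint (rs : ℝ) (p : ℝ × ℝ) (w : ℝ) : Space3 :=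
  !₂[rs * (Real.cos w * Real.cos p.1 - Real.sin w * Real.cos p.2 * Real.sin p.1),
     rs * (Real.cos w * Real.sin p.1 + Real.sin w * Real.cos p.2 * Real.cos p.1),
     rs * (Real.sin w * Real.sin p.2)]

/-- The arc length measure on the orbit of radius `rs` with parameters `p`. -/
def orbitLength (rs : ℝ) (p : ℝ × ℝ) : Measure Space3 :=
  ENNReal.ofReal rs • (volume.restrict (Ico 0 (2 * Real.pi))).map (orbitPoint rs p)

/-- The intensity measure of the satellites given the configuration `ξ` of orbits: the sum, over
the points `p` of `ξ`, of `mu / (2π rs)` times arc length on the orbit with parameters `p`. -/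
def satelliteIntensity (rs mu : ℝ) (ξ : Measure (ℝ × ℝ)) : Measure Space3 :=
  ξ.bind fun p => ENNReal.ofReal (mu / (2 * Real.pi * rs)) • orbitLength rs p

/-- The satellite constellation: `Ξ` is the Poisson process of orbits with mean number of orbits
`lam`, and `Ψ` is the process of satellites, which are, given the orbits, Poisson on the orbits
with a mean number of `mu` satellites per orbit. -/
structure IsSatelliteCox {Ω : Type*} [MeasurableSpace Ω] (P : Measure Ω) [IsFiniteMeasure P]
    (rs lam mu : ℝ) (Ξ : Ω → Measure (ℝ × ℝ)) (Ψ : Ω → Measure Space3) : Prop where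
  orbits : IsPoissonPointProcess P Ξ (orbitIntensity lam)
  satellites : IsCoxPointProcess P Ξ Ψ (satelliteIntensity rs mu)

/-! ### The typical terrestrial gateway -/

/-- The typical gateway, at the North pole of the Earth of radius `re`. -/
def gateway (re : ℝ) : Space3 := !₂[0, 0, re]

/-- The elevation angle of `X` seen from the typical gateway: the signed angle between the segment
from the gateway to `X` and the horizontal plane at the gateway. -/
def elevation (re : ℝ) (X : Space3) : ℝ :=
  Real.pi / 2 - InnerProductGeometry.angle (X - gateway re) (gateway re)

/-- The event that the typical gateway is connected without aerial platforms: there is at least one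
satellite whose elevation angle is greater than `κ`. -/
def connectedEvent {Ω : Type*} (re κ : ℝ) (Ψ : Ω → Measure Space3) : Set Ω :=
  {ω | 1 ≤ Ψ ω {X | κ < elevation re X}}

end

/-! Given the orbits, the number of visible satellites is Poisson, with mean the sum over the orbits
of the mean visible number `f p`. The probability of seeing none is therefore the expectation of
`exp (-∑ f p)` (`IsCoxPointProcess.measure_lt_one`). The Laplace functional of the Poisson process
of orbits turns it into `exp (-∫ (1 - exp (-f)) dΛ)` (`IsPoissonPointProcess.lintegral_expNeg`).

The function `f` comes from geometry. A satellite is visible exactly when its height exceeds `rs *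
cos ξ` (`lt_elevation_iff`). On an orbit of inclination `φ` the height is `rs * sin w * sin φ`, so
the visible arc is `sin w > cos ξ / sin φ`, of angle `2 arccos (cos ξ / sin φ)` (`volume_lt_sin`,
`orbitLength_visible`). Integrating out the longitude and shifting `φ` by `π / 2` gives the stated
integral.

Working in `[0, ∞]` with `exp (-∞) = 0` avoids finiteness conditions on the counts and intensities.
-/

open Filter Topology

/-! ### The function `x ↦ exp (-x)` on `[0, ∞]` -/

/-- The function `x ↦ exp (-x)` on `[0, ∞]`, with value `0` at `∞`. -/
noncomputable def expNeg (x : ℝ≥0∞) : ℝ≥0∞ := EReal.exp (-(x : EReal))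

@[simp] lemma expNeg_zero : expNeg 0 = 1 := by simp [expNeg]

@[simp] lemma expNeg_top : expNeg ∞ = 0 := by simp [expNeg]

lemma expNeg_coe (x : ℝ≥0) : expNeg x = ENNReal.ofReal (Real.exp (-x)) := by
  rw [expNeg, EReal.coe_nnreal_eq_coe_real, ← EReal.coe_neg, EReal.exp_coe]

lemma expNeg_ofReal {x : ℝ} (hx : 0 ≤ x) :
    expNeg (ENNReal.ofReal x) = ENNReal.ofReal (Real.exp (-x)) := by
  rw [ENNReal.ofReal, expNeg_coe, Real.coe_toNNReal x hx]

lemma expNeg_add (x y : ℝ≥0∞) : expNeg (x + y) = expNeg x * expNeg y := by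
  induction x with
  | top => simp
  | coe x =>
    induction y with
    | top => simp
    | coe y =>
      rw [← ENNReal.coe_add, expNeg_coe, expNeg_coe, expNeg_coe,
        ← ENNReal.ofReal_mul (Real.exp_nonneg _), ← Real.exp_add, NNReal.coe_add, neg_add]

lemma expNeg_sum {ι : Type*} (s : Finset ι) (f : ι → ℝ≥0∞) :
    expNeg (∑ i ∈ s, f i) = ∏ i ∈ s, expNeg (f i) := by
  classical
  induction s using Finset.induction_on with
  | empty => simp
  | insert a s ha ih => rw [Finset.sum_insert ha, Finset.prod_insert ha, expNeg_add, ih]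

lemma expNeg_mul_natCast (x : ℝ≥0∞) (n : ℕ) : expNeg (x * n) = expNeg x ^ n := by
  induction n with
  | zero => simp
  | succ n ih => rw [Nat.cast_succ, mul_add, mul_one, expNeg_add, ih, pow_succ]

lemma continuous_expNeg : Continuous expNeg :=
  ENNReal.continuous_exp.comp (continuous_neg.comp continuous_coe_ennreal_ereal)

@[fun_prop] lemma measurable_expNeg : Measurable expNeg := continuous_expNeg.measurable

lemma antitone_expNeg : Antitone expNeg := fun _ _ h =>
  EReal.exp_monotone (EReal.neg_le_neg_iff.2 (EReal.coe_ennreal_le_coe_ennreal_iff.2 h))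

lemma expNeg_le_one (x : ℝ≥0∞) : expNeg x ≤ 1 := by
  simpa using antitone_expNeg (bot_le (a := x))

/-! ### The Poisson law -/

instance isProbabilityMeasure_poissonLaw (r : ℝ≥0∞) : IsProbabilityMeasure (poissonLaw r) := by
  unfold poissonLaw
  split_ifs
  · infer_instance
  · exact Measure.isProbabilityMeasure_map (Measurable.of_discrete).aemeasurable

lemma poissonLaw_top : poissonLaw ∞ = Measure.dirac ∞ := if_pos rfl

lemma poissonLaw_coe (r : ℝ≥0) :
    poissonLaw r = (poissonMeasure r).map (fun k : ℕ => (k : ℝ≥0∞)) := by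
  simp [poissonLaw]

/-- The probability that a Poisson variable vanishes. -/
lemma poissonLaw_Iio_one (r : ℝ≥0∞) : poissonLaw r (Iio 1) = expNeg r := by
  induction r with
  | top => simp [poissonLaw_top]
  | coe r =>
    have h : (fun k : ℕ => (k : ℝ≥0∞)) ⁻¹' Iio 1 = {0} := by
      ext k
      simp
    rw [poissonLaw_coe, Measure.map_apply Measurable.of_discrete measurableSet_Iio, h,
      poissonMeasure_singleton, expNeg_coe]
    simp

/-- The Laplace transform of the Poisson law. -/
lemma lintegral_expNeg_mul_poissonLaw (c r : ℝ≥0∞) :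
    ∫⁻ x, expNeg (c * x) ∂poissonLaw r = expNeg ((1 - expNeg c) * r) := by
  induction r with
  | top =>
    rw [poissonLaw_top, lintegral_dirac' _ (by fun_prop)]
    -- Since `0 * ∞ = 0`, both sides are `1` when `c = 0`; otherwise both are `exp (-∞) = 0`.
    rcases eq_or_ne c 0 with rfl | hc
    · simp
    · have h : expNeg c < 1 := by
        rw [expNeg, EReal.exp_lt_one_iff, EReal.neg_lt_comm]
        simpa using pos_iff_ne_zero.2 hc
      rw [ENNReal.mul_top hc, ENNReal.mul_top (tsub_pos_of_lt h).ne']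
  | coe r =>
    have hq : expNeg c ≠ ∞ := ((expNeg_le_one c).trans_lt ENNReal.one_lt_top).ne
    rw [poissonLaw_coe, lintegral_map (by fun_prop) Measurable.of_discrete]
    simp_rw [expNeg_mul_natCast]
    have hq1 := expNeg_le_one c
    generalize expNeg c = q at hq hq1
    lift q to ℝ≥0 using hq
    have hq1' : q ≤ 1 := by exact_mod_cast hq1
    have e : (1 - (q : ℝ≥0∞)) * r = (((1 - q) * r : ℝ≥0) : ℝ≥0∞) := by push_cast; rfl
    rw [e, expNeg_coe, poissonMeasure, lintegral_sum_measure]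
    have hs : HasSum (fun n : ℕ => Real.exp (-r) * ((r * q : ℝ) ^ n / n.factorial))
        (Real.exp (-r) * Real.exp (r * q)) := by
      rw [Real.exp_eq_exp_ℝ]
      exact (NormedSpace.expSeries_div_hasSum_exp (r * q : ℝ)).mul_left _
    calc ∑' n : ℕ, ∫⁻ a : ℕ, (q : ℝ≥0∞) ^ a
          ∂(ENNReal.ofReal (Real.exp (-r) * r ^ n / n.factorial) • Measure.dirac n)
        = ∑' n : ℕ, ENNReal.ofReal (Real.exp (-r) * ((r * q : ℝ) ^ n / n.factorial)) := by
          refine tsum_congr fun n => ?_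
          rw [lintegral_smul_measure, lintegral_dirac, smul_eq_mul, ← ENNReal.coe_pow,
            ← ENNReal.ofReal_coe_nnreal, ← ENNReal.ofReal_mul (by positivity)]
          congr 1
          push_cast
          ring
      _ = ENNReal.ofReal (Real.exp (-r) * Real.exp (r * q)) := by
          rw [← hs.tsum_eq, ENNReal.ofReal_tsum_of_nonneg (fun n => by positivity) hs.summable]
      _ = ENNReal.ofReal (Real.exp (-((1 - q) * r : ℝ≥0))) := by
          rw [← Real.exp_add]
          congr 2
          push_cast [NNReal.coe_sub hq1']
          ring

/-! ### The Laplace functional of a Poisson point process -/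

section Laplace

variable {Ω S : Type*} [MeasurableSpace Ω] [MeasurableSpace S] {P : Measure Ω}
  {N : Ω → Measure S} {Λ : Measure S}

/-- Counts in disjoint sets are independent, so the expectation factors into Laplace transforms of
Poisson laws. -/
lemma IsPoissonPointProcess.lintegral_prod_expNeg (hN : IsPoissonPointProcess P N Λ)
    {ι : Type*} [Fintype ι] (B : ι → Set S) (hB : ∀ i, MeasurableSet (B i))
    (hd : Pairwise fun i j => Disjoint (B i) (B j)) (c : ι → ℝ≥0∞) :
    ∫⁻ ω, ∏ i, expNeg (c i * N ω (B i)) ∂P = ∏ i, expNeg ((1 - expNeg (c i)) * Λ (B i)) := by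
  let e := Fintype.equivFin ι
  have key : ∀ (n : ℕ) (B : Fin n → Set S), (∀ i, MeasurableSet (B i)) →
      (Pairwise fun i j => Disjoint (B i) (B j)) → ∀ c : Fin n → ℝ≥0∞,
      ∫⁻ ω, ∏ i, expNeg (c i * N ω (B i)) ∂P
        = ∏ i, expNeg ((1 - expNeg (c i)) * Λ (B i)) := by
    intro n B hB hd c
    have hm : Measurable fun ω i => N ω (B i) := measurable_pi_lambda _ fun i =>
      (Measure.measurable_coe (hB i)).comp hN.pointProcess.measurable
    have h1 : ∫⁻ ω, ∏ i, expNeg (c i * N ω (B i)) ∂P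
        = ∫⁻ v, ∏ i, expNeg (c i * v i) ∂(P.map fun ω i => N ω (B i)) := by
      rw [lintegral_map (by fun_prop) hm]
    rw [h1, hN.law n B hB hd]
    have hI := iIndepFun_pi (μ := fun i => poissonLaw (Λ (B i)))
      (X := fun i x => expNeg (c i * x)) fun i => by fun_prop
    rw [lintegral_prod_eq_prod_lintegral_of_indepFun Finset.univ _ hI fun i => by fun_prop]
    refine Finset.prod_congr rfl fun i _ => ?_
    rw [← lintegral_expNeg_mul_poissonLaw,
      ← (measurePreserving_eval (fun i => poissonLaw (Λ (B i))) i).lintegral_comp (by fun_prop)]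
  have := key _ (B ∘ e.symm) (fun i => hB _) (fun i j h => hd (e.symm.injective.ne h)) (c ∘ e.symm)
  rw [← e.symm.prod_comp]
  simpa only [Function.comp, ← e.symm.prod_comp fun i => expNeg (c i * N _ (B i))] using this

/-- The level sets of `s` are disjoint, so this is the previous product formula with the values of
`s` as coefficients. -/
lemma IsPoissonPointProcess.lintegral_expNeg_simpleFunc (hN : IsPoissonPointProcess P N Λ)
    (s : SimpleFunc S ℝ≥0∞) :
    ∫⁻ ω, expNeg (∫⁻ p, s p ∂N ω) ∂P = expNeg (∫⁻ p, 1 - expNeg (s p) ∂Λ) := by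
  have hR : ∫⁻ p, 1 - expNeg (s p) ∂Λ
      = ∑ x ∈ s.range, (1 - expNeg x) * Λ (s ⁻¹' {x}) := by
    rw [← SimpleFunc.map_lintegral (fun x => 1 - expNeg x), ← SimpleFunc.lintegral_eq_lintegral]
    rfl
  have hL : ∀ ω, ∫⁻ p, s p ∂N ω = ∑ x ∈ s.range, x * N ω (s ⁻¹' {x}) := fun ω => by
    rw [SimpleFunc.lintegral_eq_lintegral]
    rfl
  simp only [hR, hL, expNeg_sum]
  have := hN.lintegral_prod_expNeg (fun x : s.range => s ⁻¹' {x.1})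
    (fun x => s.measurableSet_preimage _)
    (fun x y h => Disjoint.preimage _ (by simpa using fun h' => h (Subtype.ext h')))
    fun x => x.1
  rw [← Finset.prod_coe_sort s.range fun x => expNeg ((1 - expNeg x) * Λ (s ⁻¹' {x})), ← this]
  exact lintegral_congr fun ω =>
    (Finset.prod_coe_sort s.range fun x => expNeg (x * N ω (s ⁻¹' {x}))).symm

/-- The Laplace functional of a Poisson point process. -/
theorem IsPoissonPointProcess.lintegral_expNeg [IsFiniteMeasure P]
    (hN : IsPoissonPointProcess P N Λ) {f : S → ℝ≥0∞} (hf : Measurable f) :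
    ∫⁻ ω, expNeg (∫⁻ p, f p ∂N ω) ∂P = expNeg (∫⁻ p, 1 - expNeg (f p) ∂Λ) := by
  -- Approximate `f` from below by simple functions: the left side converges by domination by `1`,
  -- the right side by monotone convergence, as `1 - exp (-x)` increases.
  have hL : Tendsto (fun n => ∫⁻ ω, expNeg (∫⁻ p, SimpleFunc.eapprox f n p ∂N ω) ∂P) atTop
      (𝓝 (∫⁻ ω, expNeg (∫⁻ p, f p ∂N ω) ∂P)) := by
    refine tendsto_lintegral_of_dominated_convergence (fun _ => 1) (fun n => ?_)
      (fun n => ae_of_all _ fun ω => expNeg_le_one _) (by simp) (ae_of_all _ fun ω => ?_)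
    · exact measurable_expNeg.comp ((Measure.measurable_lintegral
        (SimpleFunc.eapprox f n).measurable).comp hN.pointProcess.measurable)
    · exact (continuous_expNeg.tendsto _).comp <| lintegral_tendsto_of_tendsto_of_monotone
        (fun n => (SimpleFunc.eapprox f n).measurable.aemeasurable)
        (ae_of_all _ fun p i j h => SimpleFunc.monotone_eapprox f h p)
        (ae_of_all _ fun p => SimpleFunc.tendsto_eapprox hf p)
  have hR : Tendsto (fun n => expNeg (∫⁻ p, 1 - expNeg (SimpleFunc.eapprox f n p) ∂Λ)) atTop
      (𝓝 (expNeg (∫⁻ p, 1 - expNeg (f p) ∂Λ))) := by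
    refine (continuous_expNeg.tendsto _).comp <| lintegral_tendsto_of_tendsto_of_monotone
      (fun n => ?_) (ae_of_all _ fun p i j h => ?_) (ae_of_all _ fun p => ?_)
    · exact (measurable_const.sub
        (measurable_expNeg.comp (SimpleFunc.eapprox f n).measurable)).aemeasurable
    · exact tsub_le_tsub_left (antitone_expNeg (SimpleFunc.monotone_eapprox f h p)) 1
    · exact ENNReal.Tendsto.sub tendsto_const_nhds
        ((continuous_expNeg.tendsto _).comp (SimpleFunc.tendsto_eapprox hf p))
        (Or.inl ENNReal.one_ne_top)
  refine tendsto_nhds_unique hL (hR.congr fun n => ?_)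
  rw [hN.lintegral_expNeg_simpleFunc]

end Laplace

/-- The void probabilities of a Cox point process. -/
theorem IsCoxPointProcess.measure_lt_one {Ω S E : Type*} [MeasurableSpace Ω] [MeasurableSpace S]
    [MeasurableSpace E] {P : Measure Ω} [IsFiniteMeasure P] {Ξ : Ω → Measure S}
    {N : Ω → Measure E} {Λ : Measure S → Measure E} (hΞ : Measurable Ξ)
    (hN : IsCoxPointProcess P Ξ N Λ) {B : Set E} (hB : MeasurableSet B) :
    P {ω | N ω B < 1} = ∫⁻ ω, expNeg (Λ (Ξ ω) B) ∂P := by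
  have hm : Measurable fun ω (_ : Fin 1) => N ω B := measurable_pi_lambda _ fun i =>
    (Measure.measurable_coe hB).comp hN.pointProcess.measurable
  have hT : MeasurableSet (univ.pi fun _ : Fin 1 => Iio (1 : ℝ≥0∞)) :=
    MeasurableSet.univ_pi fun _ => measurableSet_Iio
  have h := setLIntegral_preimage_condDistrib (μ := P) hΞ hm.aemeasurable hT MeasurableSet.univ
  have hc := ae_of_ae_map hΞ.aemeasurable
    (hN.condLaw 1 (fun _ => B) (fun _ => hB) fun i j h => (h (Subsingleton.elim i j)).elim)
  rw [preimage_univ, Measure.restrict_univ, univ_inter] at h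
  have hs : {ω | N ω B < 1} = (fun ω (_ : Fin 1) => N ω B) ⁻¹' univ.pi fun _ => Iio 1 := by
    ext ω
    simp
  rw [hs, ← h]
  refine lintegral_congr_ae (hc.mono fun ω hω => ?_)
  simp only [hω]
  rw [Measure.pi_pi]
  simp [poissonLaw_Iio_one]
/-! ### Visibility of a satellite -/

/-- A point of the sphere of radius `rs` has elevation greater than `κ` if and only if its height
exceeds that of the points at distance `y` from the gateway with elevation exactly `κ`. -/
lemma lt_elevation_iff {re rs κ y : ℝ} (hre : 0 < re) (hrs : re < rs) (hκ₀ : 0 ≤ κ)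
    (hκ₁ : κ ≤ Real.pi / 2) (hy0 : 0 ≤ y) (hy : y ^ 2 + 2 * re * y * Real.sin κ = rs ^ 2 - re ^ 2)
    {X : Space3} (hX : X 0 ^ 2 + X 1 ^ 2 + X 2 ^ 2 = rs ^ 2) :
    κ < elevation re X ↔ re + y * Real.sin κ < X 2 := by
  have hs0 : 0 ≤ Real.sin κ := Real.sin_nonneg_of_nonneg_of_le_pi hκ₀ (by linarith [Real.pi_pos])
  have hz : X 2 ≤ rs := by nlinarith [sq_nonneg (X 0), sq_nonneg (X 1)]
  have hn : ‖gateway re‖ = re := by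
    simp [gateway, EuclideanSpace.norm_eq, Fin.sum_univ_three, Real.sqrt_sq hre.le]
  have hi : inner ℝ (X - gateway re) (gateway re) = (X 2 - re) * re := by
    simp [gateway, PiLp.inner_apply, Fin.sum_univ_three, mul_comm]
  have hd : ‖X - gateway re‖ ^ 2 = rs ^ 2 - re ^ 2 - 2 * re * (X 2 - re) := by
    rw [EuclideanSpace.norm_sq_eq]
    simp [gateway, Fin.sum_univ_three]
    linarith
  have hd0 : 0 < ‖X - gateway re‖ := by
    have : 0 < ‖X - gateway re‖ ^ 2 := by
      rw [hd]
      nlinarith [sq_pos_of_pos (sub_pos.2 hrs)]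
    exact norm_pos_iff.2 fun h => by simp [h] at this
  have hc := InnerProductGeometry.cos_angle (X - gateway re) (gateway re)
  rw [hi, hn, mul_div_mul_right _ _ hre.ne'] at hc
  generalize ‖X - gateway re‖ = d at *
  -- The sine of the elevation is `(X 2 - re) / d`.
  have h1 : κ < elevation re X ↔ Real.sin κ * d < X 2 - re := by
    rw [← lt_div_iff₀ hd0, ← hc, ← Real.cos_pi_div_two_sub,
      Real.strictAntiOn_cos.lt_iff_gt ⟨by linarith, by linarith⟩
        ⟨InnerProductGeometry.angle_nonneg _ _, InnerProductGeometry.angle_le_pi _ _⟩, elevation]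
    constructor <;> intro h <;> linarith
  -- On the sphere, higher points are nearer to the gateway: comparing `X 2` with the threshold
  -- height amounts to comparing `d` with `y`.
  have h2 : 2 * re * (X 2 - re - y * Real.sin κ) = y ^ 2 - d ^ 2 := by linarith
  rw [h1]
  constructor <;> intro h
  · by_contra! h3
    have h4 : y ≤ d := by
      refine (sq_le_sq₀ hy0 hd0.le).1 ?_
      nlinarith
    nlinarith
  · have h4 : d ≤ y := by
      refine (sq_le_sq₀ hd0.le hy0).1 ?_
      nlinarith
    nlinarith

lemma measurable_elevation (re : ℝ) : Measurable (elevation re) := by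
  unfold elevation InnerProductGeometry.angle
  exact measurable_const.sub (Real.continuous_arccos.measurable.comp (by fun_prop))

/-! ### Visible part of an orbit -/

lemma orbitPoint_sq_sum (rs : ℝ) (p : ℝ × ℝ) (w : ℝ) :
    orbitPoint rs p w 0 ^ 2 + orbitPoint rs p w 1 ^ 2 + orbitPoint rs p w 2 ^ 2 = rs ^ 2 := by
  simp only [orbitPoint, PiLp.toLp_apply, Matrix.cons_val]
  have h1 := Real.sin_sq_add_cos_sq p.1
  have h2 := Real.sin_sq_add_cos_sq p.2
  have h3 := Real.sin_sq_add_cos_sq w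
  linear_combination rs ^ 2 * (Real.cos w ^ 2 + Real.sin w ^ 2 * Real.cos p.2 ^ 2) * h1
    + rs ^ 2 * Real.sin w ^ 2 * h2 + rs ^ 2 * h3

lemma continuous_orbitPoint (rs : ℝ) :
    Continuous fun q : (ℝ × ℝ) × ℝ => orbitPoint rs q.1 q.2 := by
  unfold orbitPoint
  refine (PiLp.continuous_toLp 2 _).comp (continuous_pi fun i => ?_)
  fin_cases i <;> simp <;> fun_prop

lemma orbitLength_apply (rs : ℝ) (p : ℝ × ℝ) {B : Set Space3} (hB : MeasurableSet B) :
    orbitLength rs p B = ENNReal.ofReal rs *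
      volume (orbitPoint rs p ⁻¹' B ∩ Ico 0 (2 * Real.pi)) := by
  have hc : Measurable (orbitPoint rs p) :=
    ((continuous_orbitPoint rs).comp (Continuous.prodMk_right p)).measurable
  rw [orbitLength, Measure.smul_apply, smul_eq_mul, Measure.map_apply hc hB,
    Measure.restrict_apply (hc hB)]

lemma measurable_orbitLength_apply (rs : ℝ) {B : Set Space3} (hB : MeasurableSet B) :
    Measurable fun p => orbitLength rs p B := by
  have hS : MeasurableSet {q : (ℝ × ℝ) × ℝ | orbitPoint rs q.1 q.2 ∈ B ∧
      q.2 ∈ Ico 0 (2 * Real.pi)} :=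
    ((continuous_orbitPoint rs).measurable hB).inter (measurable_snd measurableSet_Ico)
  have := (measurable_measure_prodMk_left (ν := (volume : Measure ℝ)) hS).const_mul
    (ENNReal.ofReal rs)
  simp_rw [orbitLength_apply rs _ hB]
  exact this

lemma satelliteIntensity_apply (rs mu : ℝ) (ξ : Measure (ℝ × ℝ)) {B : Set Space3}
    (hB : MeasurableSet B) :
    satelliteIntensity rs mu ξ B =
      ∫⁻ p, ENNReal.ofReal (mu / (2 * Real.pi * rs)) * orbitLength rs p B ∂ξ := by
  have hm : Measurable fun p =>
      ENNReal.ofReal (mu / (2 * Real.pi * rs)) • orbitLength rs p :=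
    Measure.measurable_of_measurable_coe _ fun C hC =>
      (measurable_orbitLength_apply rs hC).const_mul _
  rw [satelliteIntensity, Measure.bind_apply hB hm.aemeasurable]
  rfl

/-- The length of the part of the circle where the sine exceeds a positive level. -/
lemma volume_lt_sin {a : ℝ} (ha : 0 < a) :
    volume ({w | a < Real.sin w} ∩ Ico 0 (2 * Real.pi)) = ENNReal.ofReal (2 * Real.arccos a) := by
  have h0 := Real.arcsin_nonneg.2 ha.le
  have h1 := Real.arcsin_le_pi_div_two a
  have hpi := Real.pi_pos
  -- For `a ≥ 1` the interval is empty, in agreement with `arccos a = 0`.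
  have : {w | a < Real.sin w} ∩ Ico 0 (2 * Real.pi)
      = Ioo (Real.arcsin a) (Real.pi - Real.arcsin a) := by
    ext w
    simp only [mem_inter_iff, mem_ofPred_eq, mem_Ico, mem_Ioo]
    have key : ∀ v, 0 ≤ v → v ≤ Real.pi / 2 → (a < Real.sin v ↔ Real.arcsin a < v) :=
      fun v hv hv' => (Real.arcsin_lt_iff_lt_sin' ⟨by linarith, hv'⟩).symm
    constructor
    · rintro ⟨hw, hw0, hw2⟩
      have hwp : w < Real.pi := by
        by_contra! h
        have := Real.sin_nonneg_of_nonneg_of_le_pi (x := w - Real.pi) (by linarith) (by linarith)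
        rw [Real.sin_sub_pi] at this
        linarith
      rcases le_total w (Real.pi / 2) with h | h
      · have := (key w hw0 h).1 hw
        exact ⟨this, by linarith⟩
      · rw [← Real.sin_pi_sub] at hw
        have := (key _ (by linarith) (by linarith)).1 hw
        exact ⟨by linarith, by linarith⟩
    · rintro ⟨hw, hw'⟩
      refine ⟨?_, by linarith, by linarith⟩
      rcases le_total w (Real.pi / 2) with h | h
      · exact (key w (by linarith) h).2 hw
      · rw [← Real.sin_pi_sub]
        exact (key _ (by linarith) (by linarith)).2 (by linarith)
  rw [this, Real.volume_Ioo, Real.arccos]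
  congr 1
  ring

/-- The mean number of visible satellites on an orbit of inclination `φ`, where `c` is the cosine
of the central angle at which satellites become visible. -/
noncomputable def meanVisible (mu c φ : ℝ) : ℝ :=
  mu / Real.pi * Real.arcsin √(1 - c ^ 2 * (Real.sin φ)⁻¹ ^ 2)

lemma meanVisible_nonneg {mu : ℝ} (hmu : 0 ≤ mu) (c φ : ℝ) : 0 ≤ meanVisible mu c φ :=
  mul_nonneg (div_nonneg hmu Real.pi_pos.le) (Real.arcsin_nonneg.2 (Real.sqrt_nonneg _))

lemma measurable_meanVisible (mu c : ℝ) : Measurable (meanVisible mu c) :=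
  (Real.continuous_arcsin.measurable.comp (by fun_prop)).const_mul _

/-- If `c > sin φ` nothing is visible, and the formula still holds because the square root of a
negative number is `0`. -/
lemma orbitLength_visible {re rs κ y c : ℝ} (hre : 0 < re) (hrs : re < rs) (hκ₀ : 0 ≤ κ)
    (hκ₁ : κ ≤ Real.pi / 2) (hy0 : 0 ≤ y) (hy : y ^ 2 + 2 * re * y * Real.sin κ = rs ^ 2 - re ^ 2)
    (hc : rs * c = re + y * Real.sin κ) (hc0 : 0 < c) {mu : ℝ} (hmu : 0 ≤ mu) (p : ℝ × ℝ)
    (hp : 0 < Real.sin p.2) :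
    ENNReal.ofReal (mu / (2 * Real.pi * rs)) * orbitLength rs p {X | κ < elevation re X}
      = ENNReal.ofReal (meanVisible mu c p.2) := by
  have hrs0 : 0 < rs := hre.trans hrs
  have hpi := Real.pi_pos
  have hB : MeasurableSet {X : Space3 | κ < elevation re X} :=
    measurableSet_lt measurable_const (measurable_elevation re)
  have hset : orbitPoint rs p ⁻¹' {X | κ < elevation re X} =
      {w | c / Real.sin p.2 < Real.sin w} := by
    ext w
    rw [mem_preimage, mem_ofPred_eq, mem_ofPred_eq,
      lt_elevation_iff hre hrs hκ₀ hκ₁ hy0 hy (orbitPoint_sq_sum rs p w), ← hc, div_lt_iff₀ hp]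
    exact mul_lt_mul_iff_right₀ hrs0
  rw [orbitLength_apply rs p hB, hset, volume_lt_sin (div_pos hc0 hp),
    ← ENNReal.ofReal_mul hrs0.le, ← ENNReal.ofReal_mul (by positivity),
    Real.arccos_eq_arcsin (div_pos hc0 hp).le, meanVisible, div_pow, inv_pow, ← div_eq_mul_inv]
  congr 1
  field_simp

/-! ### Integration over the orbits -/

lemma integral_even_symm {h : ℝ → ℝ} (heven : ∀ x, h (-x) = h x)
    (hint : ∀ a b, IntervalIntegrable h volume a b) (b : ℝ) :
    ∫ x in -b..b, h x = 2 * ∫ x in 0..b, h x := by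
  have h1 := intervalIntegral.integral_comp_neg (a := 0) (b := b) h
  simp only [heven, neg_zero] at h1
  rw [← intervalIntegral.integral_add_adjacent_intervals (hint (-b) 0) (hint 0 b), ← h1]
  ring

lemma intervalIntegrable_mul_one_sub_exp {t g : ℝ → ℝ} (ht : Measurable t) (ht1 : ∀ x, |t x| ≤ 1)
    (hg : Measurable g) (hg0 : ∀ x, 0 ≤ g x) (a b : ℝ) :
    IntervalIntegrable (fun x => t x * (1 - Real.exp (-g x))) volume a b := by
  refine (intervalIntegrable_const (c := (1 : ℝ))).mono_fun (by fun_prop)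
    (ae_of_all _ fun x => ?_)
  have h1 : Real.exp (-g x) ≤ 1 := Real.exp_le_one_iff.2 (neg_nonpos.2 (hg0 x))
  have h2 := Real.exp_pos (-g x)
  simp only [norm_mul, norm_one]
  rw [Real.norm_eq_abs, Real.norm_eq_abs, abs_of_nonneg (sub_nonneg.2 h1)]
  exact mul_le_one₀ (ht1 x) (by linarith) (by linarith)

/-- The shift by `π / 2` makes the integrand even on `[-π/2, π/2]`, and it vanishes beyond `ξ`,
where orbits stay below the visible cap. -/
lemma integral_sin_mul_meanVisible {mu ξ : ℝ} (hmu : 0 ≤ mu) (hξ0 : 0 ≤ ξ)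
    (hξ1 : ξ ≤ Real.pi / 2) :
    ∫ φ in 0..Real.pi, Real.sin φ * (1 - Real.exp (-meanVisible mu (Real.cos ξ) φ)) =
      2 * ∫ φ in (0 : ℝ)..ξ, Real.cos φ * (1 - Real.exp (-(mu / Real.pi) *
          Real.arcsin √(1 - Real.cos ξ ^ 2 * (Real.cos φ)⁻¹ ^ 2))) := by
  set h : ℝ → ℝ := fun φ => Real.cos φ * (1 - Real.exp (-(mu / Real.pi *
    Real.arcsin √(1 - Real.cos ξ ^ 2 * (Real.cos φ)⁻¹ ^ 2)))) with hh
  have hint : ∀ a b, IntervalIntegrable h volume a b := fun a b =>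
    intervalIntegrable_mul_one_sub_exp Real.measurable_cos Real.abs_cos_le_one
      ((Real.continuous_arcsin.measurable.comp (by fun_prop)).const_mul _)
      (fun x => mul_nonneg (div_nonneg hmu Real.pi_pos.le)
        (Real.arcsin_nonneg.2 (Real.sqrt_nonneg _))) a b
  have e1 : ∀ φ, Real.sin φ * (1 - Real.exp (-meanVisible mu (Real.cos ξ) φ))
      = h (φ - Real.pi / 2) := fun φ => by
    simp only [hh, meanVisible, Real.cos_sub_pi_div_two]
  have e2 : ∫ φ in ξ..Real.pi / 2, h φ = 0 := by
    refine (intervalIntegral.integral_congr fun φ hφ => ?_).trans intervalIntegral.integral_zero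
    rw [uIcc_of_le hξ1] at hφ
    have hc0 : 0 ≤ Real.cos φ := Real.cos_nonneg_of_neg_pi_div_two_le_of_le
      (by linarith [hφ.1, Real.pi_pos]) hφ.2
    have hc1 : Real.cos φ ≤ Real.cos ξ := Real.cos_le_cos_of_nonneg_of_le_pi hξ0
      (by linarith [hφ.2, Real.pi_pos]) hφ.1
    -- At `cos φ = 0` the inverse is `0` by convention and the radicand is `1`; the factor `cos φ`
    -- makes the integrand vanish.
    rcases hc0.eq_or_lt with h0 | h0
    · simp only [hh, ← h0, zero_mul]
    · have : 1 ≤ Real.cos ξ ^ 2 * (Real.cos φ)⁻¹ ^ 2 := by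
        rw [← mul_pow, ← div_eq_mul_inv]
        exact one_le_pow₀ ((one_le_div h0).2 hc1)
      simp only [hh, Real.sqrt_eq_zero_of_nonpos (sub_nonpos.2 this)]
      simp
  simp_rw [e1, neg_mul]
  rw [intervalIntegral.integral_comp_sub_right h, zero_sub, sub_half,
    integral_even_symm (fun x => by simp [hh]) hint,
    ← intervalIntegral.integral_add_adjacent_intervals (hint 0 ξ) (hint ξ _), e2, add_zero]

/-- Integration of a function of the inclination with respect to the intensity of the orbits. -/
lemma lintegral_orbitIntensity {lam : ℝ} (hlam : 0 ≤ lam) {g : ℝ → ℝ} (hg : Measurable g)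
    (hg0 : ∀ x, 0 ≤ g x) :
    ∫⁻ p, ENNReal.ofReal (1 - Real.exp (-g p.2)) ∂orbitIntensity lam =
      ENNReal.ofReal (lam / 2 * ∫ φ in 0..Real.pi, Real.sin φ * (1 - Real.exp (-g φ))) := by
  have hpi := Real.pi_pos
  rw [orbitIntensity, lintegral_withDensity_eq_lintegral_mul _ (by fun_prop) (by fun_prop),
    Measure.volume_eq_prod, ← Measure.prod_restrict]
  simp only [Pi.mul_apply]
  rw [lintegral_prod _ (by fun_prop)]
  -- Nothing depends on the longitude, whose integral is a factor `π`.
  simp only [lintegral_const, Measure.restrict_apply MeasurableSet.univ, univ_inter,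
    Real.volume_Ico, sub_zero]
  have h1 : ∀ φ ∈ Ico 0 Real.pi, ENNReal.ofReal (lam * Real.sin φ / (2 * Real.pi)) *
      ENNReal.ofReal (1 - Real.exp (-g φ)) =
      ENNReal.ofReal (lam / (2 * Real.pi) * (Real.sin φ * (1 - Real.exp (-g φ)))) := fun φ hφ => by
    have := Real.sin_nonneg_of_nonneg_of_le_pi hφ.1 hφ.2.le
    rw [← ENNReal.ofReal_mul (by positivity)]
    congr 1
    ring
  have hI := (intervalIntegrable_mul_one_sub_exp Real.measurable_sin Real.abs_sin_le_one hg hg0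
    0 Real.pi).const_mul (lam / (2 * Real.pi))
  rw [intervalIntegrable_iff_integrableOn_Ico_of_le hpi.le] at hI
  rw [setLIntegral_congr_fun measurableSet_Ico h1, ← ofReal_integral_eq_lintegral_ofReal hI,
    ← ENNReal.ofReal_mul' hpi.le, integral_const_mul, intervalIntegral.integral_of_le hpi.le,
    integral_Ico_eq_integral_Ioc]
  · congr 1
    field_simp
  · refine (ae_restrict_iff' measurableSet_Ico).2 (ae_of_all _ fun φ hφ => ?_)
    have h2 := Real.sin_nonneg_of_nonneg_of_le_pi hφ.1 hφ.2.le
    have h3 : Real.exp (-g φ) ≤ 1 := Real.exp_le_one_iff.2 (neg_nonpos.2 (hg0 φ))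
    exact mul_nonneg (by positivity) (mul_nonneg h2 (sub_nonneg.2 h3))

/-- The density vanishes where the sine does, so dividing by `sin φ` is harmless. -/
lemma ae_orbitIntensity_sin_pos (lam : ℝ) : ∀ᵐ p ∂orbitIntensity lam, 0 < Real.sin p.2 := by
  rw [orbitIntensity, ae_withDensity_iff (by fun_prop)]
  refine (ae_restrict_iff' (measurableSet_Ico.prod measurableSet_Ico)).2
    (ae_of_all _ fun p hp h => ?_)
  refine (Real.sin_nonneg_of_nonneg_of_le_pi hp.2.1 hp.2.2.le).lt_of_ne fun h0 => h ?_
  simp [← h0]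

/-! ### The connectivity probability. -/

theorem proposition2 {Ω : Type*} [MeasurableSpace Ω] (P : Measure Ω) [IsProbabilityMeasure P]
    (re rs lam mu κ : ℝ) (hre : 0 < re) (hrs : re < rs) (hlam : 0 ≤ lam) (hmu : 0 ≤ mu)
    (hκ₀ : 0 ≤ κ) (hκ₁ : κ ≤ Real.pi / 2)
    (Ξ : Ω → Measure (ℝ × ℝ)) (Ψ : Ω → Measure Space3)
    (hΨ : IsSatelliteCox P rs lam mu Ξ Ψ)
    (y ξ : ℝ) (hy : y = -(re * Real.sin κ) + √(rs ^ 2 - re ^ 2 * Real.cos κ ^ 2))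
    (hξ : ξ = Real.arccos ((re ^ 2 + rs ^ 2 - y ^ 2) / (2 * rs * re))) :
    P.real (connectedEvent re κ Ψ) =
      1 - Real.exp (-lam * ∫ φ in (0 : ℝ)..ξ, Real.cos φ *
        (1 - Real.exp (-(mu / Real.pi) *
          Real.arcsin √(1 - Real.cos ξ ^ 2 * (Real.cos φ)⁻¹ ^ 2)))) := by
  have hrs0 : 0 < rs := hre.trans hrs
  have hpi := Real.pi_pos
  have hs0 : 0 ≤ Real.sin κ := Real.sin_nonneg_of_nonneg_of_le_pi hκ₀ (by linarith)
  have hsc := Real.sin_sq_add_cos_sq κ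
  have hrs2 : re ^ 2 < rs ^ 2 := by gcongr
  have hD : (re * Real.sin κ) ^ 2 ≤ rs ^ 2 - re ^ 2 * Real.cos κ ^ 2 := by
    linear_combination hrs2.le + re ^ 2 * hsc
  have hy0 : 0 ≤ y := by
    have := Real.le_sqrt_of_sq_le hD
    linarith
  -- `y` is a root of the law of cosines for the distance from the gateway to the sphere at
  -- elevation `κ`.
  have hyq : y ^ 2 + 2 * re * y * Real.sin κ = rs ^ 2 - re ^ 2 := by
    have h := Real.sq_sqrt ((sq_nonneg _).trans hD)
    have : √(rs ^ 2 - re ^ 2 * Real.cos κ ^ 2) = y + re * Real.sin κ := by linarith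
    rw [this] at h
    linear_combination h - re ^ 2 * hsc
  set c := (re ^ 2 + rs ^ 2 - y ^ 2) / (2 * rs * re) with hcdef
  have hc : rs * c = re + y * Real.sin κ := by
    rw [hcdef]
    field_simp
    linear_combination -hyq
  have hc0 : 0 < c := by
    refine pos_of_mul_pos_right (a := rs) ?_ hrs0.le
    rw [hc]
    positivity
  have hc1 : c ≤ 1 := by
    have h : rs * c ≤ rs := by
      rw [hc]
      refine abs_le_of_sq_le_sq' ?_ hrs0.le |>.2
      -- Pythagoras: `(re + y sin κ)² + (y cos κ)² = rs²`.
      nlinarith [mul_nonneg (sq_nonneg y) (sq_nonneg (Real.cos κ))]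
    nlinarith
  have hcos : Real.cos ξ = c := by rw [hξ, Real.cos_arccos (by linarith) hc1]
  have hξ0 : 0 ≤ ξ := hξ ▸ Real.arccos_nonneg _
  have hξ1 : ξ ≤ Real.pi / 2 := hξ ▸ Real.arccos_le_pi_div_two.2 hc0.le
  have hB : MeasurableSet {X : Space3 | κ < elevation re X} :=
    measurableSet_lt measurable_const (measurable_elevation re)
  have hg0 := meanVisible_nonneg hmu c
  set I := ∫ φ in (0 : ℝ)..ξ, Real.cos φ * (1 - Real.exp (-(mu / Real.pi) *
    Real.arcsin √(1 - Real.cos ξ ^ 2 * (Real.cos φ)⁻¹ ^ 2))) with hI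
  have hI2 := integral_sin_mul_meanVisible hmu hξ0 hξ1
  rw [← hI, hcos] at hI2
  have hI0 : 0 ≤ I := by
    have : 0 ≤ ∫ φ in 0..Real.pi, Real.sin φ * (1 - Real.exp (-meanVisible mu c φ)) :=
      intervalIntegral.integral_nonneg hpi.le fun φ hφ =>
        mul_nonneg (Real.sin_nonneg_of_nonneg_of_le_pi hφ.1 hφ.2)
          (sub_nonneg.2 (Real.exp_le_one_iff.2 (neg_nonpos.2 (hg0 φ))))
    linarith
  have hvoid : P {ω | Ψ ω {X | κ < elevation re X} < 1}
      = ENNReal.ofReal (Real.exp (-(lam * I))) := by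
    rw [hΨ.satellites.measure_lt_one hΨ.orbits.pointProcess.measurable hB]
    simp_rw [satelliteIntensity_apply rs mu _ hB]
    rw [hΨ.orbits.lintegral_expNeg ((measurable_orbitLength_apply rs hB).const_mul _),
      ← expNeg_ofReal (mul_nonneg hlam hI0)]
    congr 1
    have hae : ∀ᵐ p ∂orbitIntensity lam, 1 - expNeg (ENNReal.ofReal (mu / (2 * Real.pi * rs)) *
        orbitLength rs p {X | κ < elevation re X}) =
        ENNReal.ofReal (1 - Real.exp (-meanVisible mu c p.2)) := by
      filter_upwards [ae_orbitIntensity_sin_pos lam] with p hp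
      rw [orbitLength_visible hre hrs hκ₀ hκ₁ hy0 hyq hc hc0 hmu p hp, expNeg_ofReal (hg0 _),
        ENNReal.ofReal_sub _ (Real.exp_nonneg _), ENNReal.ofReal_one]
    rw [lintegral_congr_ae hae, lintegral_orbitIntensity hlam (measurable_meanVisible mu c) hg0,
      hI2]
    congr 1
    ring
  have hm : MeasurableSet {ω | Ψ ω {X | κ < elevation re X} < 1} :=
    measurableSet_lt ((Measure.measurable_coe hB).comp hΨ.satellites.pointProcess.measurable)
      measurable_const
  have hcompl : connectedEvent re κ Ψ = {ω | Ψ ω {X | κ < elevation re X} < 1}ᶜ := by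
    ext ω
    simp [connectedEvent]
  rw [hcompl, probReal_compl_eq_one_sub hm, measureReal_def, hvoid,
    ENNReal.toReal_ofReal (Real.exp_nonneg _), neg_mul]
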